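/- Let the Euler numbers $E_n$ be defined by $\dfrac{2}{e^t+e^{-t}}=\sum_{n\ge 0}E_n\dfrac{t^n}{n!}$, and for a sequence $(c_k)_{k\ge 0}$ let $H_n(c_k)=\det_{0\le i,j\le n}(c_{i+j})$ denote its Hankel determinant of size $n+1$. Define $(b_k)_{k\ge 0}$ by $b_0=0$ and $b_k=(2k-1)E_{2k-2}$ for $k\ge 1$. Then for all $n\ge 1$, $$H_n(b_k)=\frac{(-1)^n}{(2^n\,n!)^4}\cdot h_n\cdot H_n\big((2k+1)E_{2k}\big),$$ where $(h_n)_{n\ge 0}$ is defined by $h_0=0$, $h_1=1$ and $h_{n+1}=(8n^2+8n+3)h_n-(2n)^4h_{n-1}$ for $n\ge 1$. -/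

import Mathlib

namespace HankelEuler

/-- The formal power series `2 / (e^t + e^{-t})` over `ℚ`. The denominator has constant
coefficient `2 ≠ 0`, so the inverse is a genuine one. -/
noncomputable def eulerSeries : PowerSeries ℚ :=
  PowerSeries.C (2 : ℚ) *
    (PowerSeries.exp ℚ + PowerSeries.rescale (-1 : ℚ) (PowerSeries.exp ℚ))⁻¹

/-- The Euler numbers `E_n`, given by `2 / (e^t + e^{-t}) = ∑ E_n t^n / n!`. -/
noncomputable def eulerNumber (n : ℕ) : ℚ :=
  (n.factorial : ℚ) * PowerSeries.coeff n eulerSeries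

/-- The Hankel determinant `H_n(c) = det (c_{i+j})_{0 ≤ i, j ≤ n}`, of size `n + 1`. -/
def hankelDet (c : ℕ → ℚ) (n : ℕ) : ℚ :=
  Matrix.det (Matrix.of fun i j : Fin (n + 1) => c ((i : ℕ) + (j : ℕ)))

/-- The sequence `c_k = (2k+1) E_{2k}`, `k ≥ 0`. -/
noncomputable def cSeq (k : ℕ) : ℚ :=
  (2 * (k : ℚ) + 1) * eulerNumber (2 * k)

/-- The shifted sequence `b_0 = 0`, `b_{k+1} = (2k+1) E_{2k}` for `k ≥ 0`. -/
noncomputable def bSeq : ℕ → ℚ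
  | 0 => 0
  | k + 1 => cSeq k

/-- `h_0 = 0`, `h_1 = 1` and `h_{m+1} = (8m²+8m+3) h_m - (2m)⁴ h_{m-1}` for `m ≥ 1`
(below, `m = n + 1`). -/
def hSeq : ℕ → ℚ
  | 0 => 0
  | 1 => 1
  | n + 2 =>
      (8 * ((n : ℚ) + 1) ^ 2 + 8 * ((n : ℚ) + 1) + 3) * hSeq (n + 1)
        - (2 * ((n : ℚ) + 1)) ^ 4 * hSeq n

end HankelEuler

namespace HankelEuler

/-! ### Moment functionals and Hankel determinants in monic bases. -/

open Polynomial

/-! Write `L_b`, `L_c` for the functionals with moments `bSeq`, `cSeq`, so `L_b (X p) = L_c p`. With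
`e_i = oddSquareProd i` and `P_j = orthoPoly j`, the values `L_c (e_i P_j)` vanish for `j > i`, so
H_n(c) is the product of the diagonal values 16^i i!^4. For H_n(b), take rows `1, X e_0, X e_1, …`
and columns `P_j`: all rows but the first are those of `L_c`, so the last column reduces to its top
entry `L_b (P_n)`, with cofactor ±H_{n-1}(c). The recurrence of `P_n`, with its `X` term killed by
orthogonality, gives `L_b (P_n) = h_n`. -/

/-- The linear functional on `ℚ[X]` with moments `c`. -/
noncomputable def momentFunctional (c : ℕ → ℚ) : ℚ[X] →ₗ[ℚ] ℚ :=
  Polynomial.lsum fun n => c n • LinearMap.id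

lemma momentFunctional_monomial (c : ℕ → ℚ) (n : ℕ) (a : ℚ) :
    momentFunctional c (monomial n a) = c n * a := by
  simp [momentFunctional, Polynomial.lsum_apply, Polynomial.sum_monomial_index]

lemma momentFunctional_X_pow (c : ℕ → ℚ) (n : ℕ) : momentFunctional c (X ^ n) = c n := by
  rw [X_pow_eq_monomial, momentFunctional_monomial, mul_one]

lemma momentFunctional_C_mul (c : ℕ → ℚ) (a : ℚ) (p : ℚ[X]) :
    momentFunctional c (C a * p) = a * momentFunctional c p := by
  rw [C_mul', map_smul, smul_eq_mul]

lemma det_coeff_of_monic (P : ℕ → ℚ[X]) (hP : ∀ i, (P i).Monic)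
    (hd : ∀ i, (P i).natDegree = i) (n : ℕ) :
    (Matrix.of fun i j : Fin n => (P i).coeff j).det = 1 := by
  rw [Matrix.det_of_isLowerTriangular]
  · refine Finset.prod_eq_one fun i _ => ?_
    have := (hP i).coeff_natDegree
    rwa [hd] at this
  · intro i j hij
    have hij : i < j := hij
    exact coeff_eq_zero_of_natDegree_lt (by rw [hd]; exact hij)

lemma momentFunctional_mul_eq_sum (c : ℕ → ℚ) (p q : ℚ[X]) (n : ℕ)
    (hp : p.natDegree < n) (hq : q.natDegree < n) :
    momentFunctional c (p * q) =
      ∑ b : Fin n, (∑ a : Fin n, p.coeff a * c (a + b)) * q.coeff b := by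
  conv_lhs => rw [p.as_sum_range_C_mul_X_pow' hp, q.as_sum_range_C_mul_X_pow' hq]
  rw [Finset.sum_mul_sum, Finset.sum_comm, map_sum, ← Fin.sum_univ_eq_sum_range
    (fun b => momentFunctional c (∑ a ∈ Finset.range n,
      C (p.coeff a) * X ^ a * (C (q.coeff b) * X ^ b)))]
  refine Finset.sum_congr rfl fun b _ => ?_
  rw [map_sum, ← Fin.sum_univ_eq_sum_range
    (fun a => momentFunctional c (C (p.coeff a) * X ^ a * (C (q.coeff b) * X ^ (b : ℕ)))),
    Finset.sum_mul]
  refine Finset.sum_congr rfl fun a _ => ?_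
  rw [show C (p.coeff a) * X ^ (a : ℕ) * (C (q.coeff b) * X ^ (b : ℕ))
    = C (p.coeff a) * (C (q.coeff b) * X ^ ((a : ℕ) + b)) by ring,
    momentFunctional_C_mul, momentFunctional_C_mul, momentFunctional_X_pow]
  ring

/-- Hankel determinants may be computed in any two monic polynomial bases. -/
lemma hankelDet_eq_det_of_monic (c : ℕ → ℚ) (P Q : ℕ → ℚ[X])
    (hP : ∀ i, (P i).Monic) (hPd : ∀ i, (P i).natDegree = i)
    (hQ : ∀ i, (Q i).Monic) (hQd : ∀ i, (Q i).natDegree = i) (n : ℕ) :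
    hankelDet c n =
      (Matrix.of fun i j : Fin (n + 1) => momentFunctional c (P i * Q j)).det := by
  -- The two change-of-basis factors are unitriangular.
  have h : (Matrix.of fun i j : Fin (n + 1) => momentFunctional c (P i * Q j)) =
      (Matrix.of fun i j : Fin (n + 1) => (P i).coeff j) *
        (Matrix.of fun i j : Fin (n + 1) => c ((i : ℕ) + (j : ℕ))) *
        (Matrix.of fun i j : Fin (n + 1) => (Q i).coeff j).transpose := by
    ext i j
    rw [Matrix.of_apply, momentFunctional_mul_eq_sum c _ _ (n + 1) (by rw [hPd]; exact i.2)
      (by rw [hQd]; exact j.2)]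
    simp [Matrix.mul_apply]
  rw [h, Matrix.det_mul, Matrix.det_mul, Matrix.det_transpose, det_coeff_of_monic P hP hPd,
    det_coeff_of_monic Q hQ hQd, hankelDet]
  ring

/-! ### The Euler functional -/

lemma eulerSeries_mul :
    eulerSeries * (PowerSeries.exp ℚ + PowerSeries.rescale (-1 : ℚ) (PowerSeries.exp ℚ)) =
      PowerSeries.C (2 : ℚ) := by
  rw [eulerSeries, mul_assoc, PowerSeries.inv_mul_cancel, mul_one]
  rw [map_add, ← PowerSeries.coeff_zero_eq_constantCoeff_apply,
    ← PowerSeries.coeff_zero_eq_constantCoeff_apply, PowerSeries.coeff_rescale]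
  norm_num

lemma sum_choose_mul_eulerNumber (n : ℕ) :
    ∑ k ∈ Finset.range (n + 1),
      (n.choose k : ℚ) * eulerNumber k * (1 + (-1) ^ (n - k)) = if n = 0 then 2 else 0 := by
  have h := congrArg (PowerSeries.coeff n) eulerSeries_mul
  rw [PowerSeries.coeff_mul, PowerSeries.coeff_C,
    Finset.Nat.sum_antidiagonal_eq_sum_range_succ_mk] at h
  have h2 : ∑ k ∈ Finset.range (n + 1),
      (n.choose k : ℚ) * eulerNumber k * (1 + (-1) ^ (n - k)) =
      (n.factorial : ℚ) * if n = 0 then 2 else 0 := by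
    rw [← h, Finset.mul_sum]
    refine Finset.sum_congr rfl fun k hk => ?_
    have hk : k ≤ n := Nat.lt_succ_iff.1 (Finset.mem_range.1 hk)
    rw [Nat.cast_choose ℚ hk, eulerNumber, map_add, PowerSeries.coeff_rescale,
      PowerSeries.coeff_exp]
    have h1 : (k.factorial : ℚ) ≠ 0 := by positivity
    have h2 : ((n - k).factorial : ℚ) ≠ 0 := by positivity
    simp only [map_div₀, map_one, map_natCast]
    field_simp
  rw [h2]
  split_ifs with h0
  · simp [h0]
  · simp

/-- The Euler functional is inverse to the averaging operator. -/
lemma momentFunctional_eulerNumber_shift (g : ℚ[X]) :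
    momentFunctional eulerNumber (g.comp (X + 1) + g.comp (X - 1)) = 2 * g.eval 0 := by
  induction g using Polynomial.induction_on' with
  | add p q hp hq =>
    rw [add_comp, add_comp, add_add_add_comm, map_add, hp, hq, eval_add]; ring
  | monomial n a =>
    have h : (monomial n a).comp (X + 1) + (monomial n a).comp (X - 1) =
        ∑ k ∈ Finset.range (n + 1),
          C (a * ((n.choose k : ℚ) * (1 + (-1) ^ (n - k)))) * X ^ k := by
      rw [monomial_comp, monomial_comp, ← mul_add, add_pow, sub_eq_add_neg, add_pow,
        ← Finset.sum_add_distrib, Finset.mul_sum]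
      refine Finset.sum_congr rfl fun k _ => ?_
      simp only [one_pow, map_mul, map_add, map_one, map_pow, map_neg, map_natCast]
      ring
    rw [h, map_sum]
    simp only [momentFunctional_C_mul, momentFunctional_X_pow]
    have h3 : ∑ k ∈ Finset.range (n + 1),
        a * ((n.choose k : ℚ) * (1 + (-1) ^ (n - k))) * eulerNumber k =
        a * if n = 0 then 2 else 0 := by
      rw [← sum_choose_mul_eulerNumber, Finset.mul_sum]
      exact Finset.sum_congr rfl fun k _ => by ring
    rw [h3]
    rcases Nat.eq_zero_or_pos n with rfl | hn
    · simp [mul_comm]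
    · simp [hn.ne', eval_monomial]

/-- The factor 2k+1 comes from differentiating X^(2k+1); this makes the shift identity for the Euler
functional available. -/
lemma momentFunctional_cSeq (p : ℚ[X]) :
    momentFunctional cSeq p =
      momentFunctional eulerNumber (derivative (X * p.comp (X ^ 2))) := by
  induction p using Polynomial.induction_on' with
  | add p q hp hq => rw [map_add, hp, hq, add_comp, mul_add, map_add, map_add]
  | monomial n a =>
    have h : X * (monomial n a).comp (X ^ 2) = C a * X ^ (2 * n + 1) := by
      rw [monomial_comp, ← pow_mul]; ring
    rw [h, derivative_C_mul_X_pow, momentFunctional_C_mul, momentFunctional_X_pow,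
      momentFunctional_monomial, cSeq, Nat.add_sub_cancel]
    push_cast
    ring

/-! ### Two families of monic polynomials -/

/-- The product `∏_{j < k} (X - (2j+1)²)`. -/
noncomputable def oddSquareProd : ℕ → ℚ[X]
  | 0 => 1
  | k + 1 => (X - C ((2 * (k : ℚ) + 1) ^ 2)) * oddSquareProd k

/-- The product `X * ∏_{1 ≤ j ≤ k} (X² - 4j²)`. -/
noncomputable def evenRootProd : ℕ → ℚ[X]
  | 0 => X
  | k + 1 => (X ^ 2 - C ((2 * (k : ℚ) + 2) ^ 2)) * evenRootProd k

/-- Shifting the roots 0, ±2, …, ±2k by one gives ±1, …, ±(2k-1) and one unpaired root -(2k+1). -/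
lemma evenRootProd_comp_X_add_one (k : ℕ) :
    (evenRootProd k).comp (X + 1) =
      (X + C (2 * (k : ℚ) + 1)) * (oddSquareProd k).comp (X ^ 2) := by
  induction k with
  | zero => simp [evenRootProd, oddSquareProd]
  | succ k ih =>
    rw [evenRootProd, mul_comp, ih, oddSquareProd, mul_comp]
    simp only [sub_comp, pow_comp, X_comp, C_comp]
    simp only [map_pow, map_add, map_mul, Nat.cast_succ, map_one, map_ofNat]
    ring

lemma evenRootProd_comp_X_sub_one (k : ℕ) :
    (evenRootProd k).comp (X - 1) =
      (X - C (2 * (k : ℚ) + 1)) * (oddSquareProd k).comp (X ^ 2) := by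
  induction k with
  | zero => simp [evenRootProd, oddSquareProd]
  | succ k ih =>
    rw [evenRootProd, mul_comp, ih, oddSquareProd, mul_comp]
    simp only [sub_comp, pow_comp, X_comp, C_comp]
    simp only [map_pow, map_add, map_mul, Nat.cast_succ, map_one, map_ofNat]
    ring

lemma momentFunctional_cSeq_oddSquareProd_succ (k : ℕ) :
    momentFunctional cSeq (oddSquareProd (k + 1)) =
      -4 * ((k : ℚ) + 1) ^ 2 * momentFunctional cSeq (oddSquareProd k) := by
  -- The factor `X ^ 2` forces g'(0) = 0, so the shift identity for g' has right side 0.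
  set g : ℚ[X] := X ^ 2 * evenRootProd k with hg
  have h1 : g.comp (X + 1) + g.comp (X - 1) =
      C 2 * (X * (oddSquareProd (k + 1) +
        C (4 * ((k : ℚ) + 1) ^ 2) * oddSquareProd k).comp (X ^ 2)) := by
    rw [hg, mul_comp, mul_comp, evenRootProd_comp_X_add_one, evenRootProd_comp_X_sub_one,
      oddSquareProd]
    simp only [add_comp, mul_comp, sub_comp, pow_comp, X_comp, C_comp]
    simp only [map_pow, map_add, map_mul, map_one, map_ofNat]
    ring
  have h2 := momentFunctional_eulerNumber_shift (derivative g)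
  have h3 : (derivative g).comp (X + 1) + (derivative g).comp (X - 1) =
      derivative (g.comp (X + 1) + g.comp (X - 1)) := by
    simp [derivative_comp]
  have h4 : (derivative g).eval 0 = 0 := by
    simp [hg, derivative_mul]
  rw [h3, h4, h1, derivative_C_mul, momentFunctional_C_mul, ← momentFunctional_cSeq, map_add,
    momentFunctional_C_mul] at h2
  linarith

lemma momentFunctional_cSeq_oddSquareProd (k : ℕ) :
    momentFunctional cSeq (oddSquareProd k) = (-4) ^ k * (k.factorial : ℚ) ^ 2 := by
  induction k with
  | zero =>
    have h0 := sum_choose_mul_eulerNumber 0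
    have h := momentFunctional_X_pow cSeq 0
    rw [pow_zero] at h
    simp only [zero_add, Finset.range_one, Finset.sum_singleton, Nat.choose_self] at h0
    simp only [oddSquareProd, h, cSeq]
    norm_num at h0 ⊢
    linarith
  | succ k ih =>
    rw [momentFunctional_cSeq_oddSquareProd_succ, ih, Nat.factorial_succ]
    push_cast
    ring

/-- The monic orthogonal polynomials of the moment sequence `cSeq` (rescaled continuous dual
Hahn polynomials with all parameters equal to `1/2`). -/
noncomputable def orthoPoly : ℕ → ℚ[X]
  | 0 => 1
  | 1 => X + C 3
  | n + 2 => (X + C (8 * ((n : ℚ) + 1) ^ 2 + 8 * ((n : ℚ) + 1) + 3)) * orthoPoly (n + 1)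
      - C ((2 * ((n : ℚ) + 1)) ^ 4) * orthoPoly n

lemma oddSquareProd_monic_natDegree (k : ℕ) :
    (oddSquareProd k).Monic ∧ (oddSquareProd k).natDegree = k := by
  induction k with
  | zero => simp [oddSquareProd]
  | succ k ih =>
    have h := monic_X_sub_C ((2 * (k : ℚ) + 1) ^ 2)
    refine ⟨h.mul ih.1, ?_⟩
    rw [oddSquareProd, h.natDegree_mul ih.1, natDegree_X_sub_C, ih.2, add_comm]

lemma orthoPoly_monic_natDegree (n : ℕ) :
    (orthoPoly n).Monic ∧ (orthoPoly n).natDegree = n := by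
  induction n using Nat.strong_induction_on with
  | _ n ih =>
    match n with
    | 0 => simp [orthoPoly]
    | 1 => exact ⟨monic_X_add_C 3, natDegree_X_add_C 3⟩
    | n + 2 =>
      obtain ⟨m1, d1⟩ := ih (n + 1) (by omega)
      obtain ⟨m0, d0⟩ := ih n (by omega)
      have h := monic_X_add_C (8 * ((n : ℚ) + 1) ^ 2 + 8 * ((n : ℚ) + 1) + 3)
      have hm := h.mul m1
      have hd := h.natDegree_mul m1
      rw [natDegree_X_add_C, d1] at hd
      have hlt : (C ((2 * ((n : ℚ) + 1)) ^ 4) * orthoPoly n).natDegree < n + 2 :=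
        (natDegree_C_mul_le _ _).trans_lt (by omega)
      rw [orthoPoly]
      refine ⟨hm.sub_of_left (degree_lt_degree (by omega)), ?_⟩
      rw [natDegree_sub_eq_left_of_natDegree_lt (by omega)]
      omega

lemma momentFunctional_X_mul_oddSquareProd (c : ℕ → ℚ) (i : ℕ) (p : ℚ[X]) :
    momentFunctional c (oddSquareProd i * (X * p)) =
      momentFunctional c (oddSquareProd (i + 1) * p) +
        (2 * (i : ℚ) + 1) ^ 2 * momentFunctional c (oddSquareProd i * p) := by
  rw [← momentFunctional_C_mul, ← map_add, oddSquareProd]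
  congr 1
  ring

lemma succ_mul_choose_succ (i n : ℕ) :
    ((n : ℚ) + 1) * (i.choose (n + 1) : ℚ) = ((i : ℚ) - n) * (i.choose n : ℚ) := by
  rcases le_or_gt n i with h | h
  · have := Nat.choose_succ_right_eq i n
    have := congrArg (Nat.cast : ℕ → ℚ) this
    push_cast [Nat.cast_sub h] at this
    linarith
  · rw [Nat.choose_eq_zero_of_lt h, Nat.choose_eq_zero_of_lt (by omega)]
    simp

/-- Orthogonality is the vanishing of `i.choose n` for i < n. The induction combines the recurrence
of `orthoPoly` with X e_i = e_{i+1} + (2i+1)² e_i. -/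
lemma momentFunctional_cSeq_oddSquareProd_mul_orthoPoly (n i : ℕ) :
    momentFunctional cSeq (oddSquareProd i * orthoPoly n) =
      (-4) ^ (i + n) * (n.factorial : ℚ) ^ 2 * (i.factorial : ℚ) ^ 2 * (i.choose n : ℚ) := by
  induction n using Nat.strong_induction_on generalizing i with
  | _ n ih =>
    match n with
    | 0 =>
      rw [orthoPoly, mul_one, momentFunctional_cSeq_oddSquareProd]
      simp
    | 1 =>
      rw [orthoPoly, mul_add, ← mul_one X, map_add, momentFunctional_X_mul_oddSquareProd, mul_one,
        mul_one, mul_comm _ (C 3), momentFunctional_C_mul, momentFunctional_cSeq_oddSquareProd,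
        momentFunctional_cSeq_oddSquareProd, Nat.factorial_succ]
      push_cast [Nat.choose_one_right]
      ring
    | n + 2 =>
      have h : oddSquareProd i * orthoPoly (n + 2) =
          oddSquareProd i * (X * orthoPoly (n + 1)) +
            C (8 * ((n : ℚ) + 1) ^ 2 + 8 * ((n : ℚ) + 1) + 3) *
              (oddSquareProd i * orthoPoly (n + 1)) -
            C ((2 * ((n : ℚ) + 1)) ^ 4) * (oddSquareProd i * orthoPoly n) := by
        rw [orthoPoly]; ring
      rw [h, map_sub, map_add, momentFunctional_X_mul_oddSquareProd, momentFunctional_C_mul,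
        momentFunctional_C_mul, ih (n + 1) (by omega), ih (n + 1) (by omega),
        ih n (by omega), Nat.factorial_succ i, Nat.factorial_succ (n + 1), Nat.factorial_succ n,
        Nat.choose_succ_succ i n]
      have h1 := succ_mul_choose_succ i (n + 1)
      have h0 := succ_mul_choose_succ i n
      push_cast at h1 ⊢
      -- After the common factor is removed, a linear relation among C(i,n), C(i,n+1), C(i,n+2)
      -- remains.
      linear_combination (-16 * ((n : ℚ) + 1) ^ 2 * (-4) ^ (i + n) * (n.factorial : ℚ) ^ 2 *
        (i.factorial : ℚ) ^ 2) * (((n : ℚ) + 2) * h1 + ((n : ℚ) + i + 2) * h0)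

/-! ### The two Hankel determinants -/

lemma hankelDet_cSeq (n : ℕ) :
    hankelDet cSeq n = ∏ i ∈ Finset.range (n + 1), (16 ^ i * (i.factorial : ℚ) ^ 4) := by
  rw [hankelDet_eq_det_of_monic cSeq oddSquareProd orthoPoly
    (fun i => (oddSquareProd_monic_natDegree i).1) (fun i => (oddSquareProd_monic_natDegree i).2)
    (fun i => (orthoPoly_monic_natDegree i).1) (fun i => (orthoPoly_monic_natDegree i).2)]
  simp only [momentFunctional_cSeq_oddSquareProd_mul_orthoPoly]
  rw [Matrix.det_of_isLowerTriangular, ← Fin.prod_univ_eq_prod_range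
    (fun i => 16 ^ i * (i.factorial : ℚ) ^ 4)]
  · refine Finset.prod_congr rfl fun i _ => ?_
    rw [Matrix.of_apply, Nat.choose_self, ← two_mul, pow_mul]
    norm_num
    ring
  · intro i j hij
    have hij : i < j := hij
    rw [Matrix.of_apply, Nat.choose_eq_zero_of_lt hij, Nat.cast_zero, mul_zero]

lemma momentFunctional_bSeq_X_mul (p : ℚ[X]) :
    momentFunctional bSeq (X * p) = momentFunctional cSeq p := by
  induction p using Polynomial.induction_on' with
  | add p q hp hq => rw [mul_add, map_add, map_add, hp, hq]
  | monomial n a => rw [X_mul_monomial, momentFunctional_monomial, momentFunctional_monomial,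
      bSeq]

lemma momentFunctional_cSeq_orthoPoly_succ (n : ℕ) :
    momentFunctional cSeq (orthoPoly (n + 1)) = 0 := by
  have h := momentFunctional_cSeq_oddSquareProd_mul_orthoPoly (n + 1) 0
  rwa [oddSquareProd, one_mul, Nat.choose_zero_succ, Nat.cast_zero, mul_zero] at h

/-- Since `L_b (X P_{n+1}) = L_c (P_{n+1}) = 0`, only the constant coefficients of the recurrence
survive, and they are those of `hSeq`. -/
lemma momentFunctional_bSeq_orthoPoly (n : ℕ) :
    momentFunctional bSeq (orthoPoly n) = hSeq n := by
  induction n using Nat.strong_induction_on with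
  | _ n ih =>
    match n with
    | 0 =>
      rw [orthoPoly, ← pow_zero X, momentFunctional_X_pow, bSeq, hSeq]
    | 1 =>
      have h := momentFunctional_cSeq_oddSquareProd 0
      have h0 := momentFunctional_X_pow bSeq 0
      rw [pow_zero, bSeq] at h0
      rw [orthoPoly, map_add, ← mul_one X, ← mul_one (C 3), momentFunctional_bSeq_X_mul,
        momentFunctional_C_mul, h0, hSeq]
      simpa [oddSquareProd] using h
    | n + 2 =>
      rw [orthoPoly, add_mul, map_sub, map_add, momentFunctional_bSeq_X_mul,
        momentFunctional_C_mul, momentFunctional_C_mul, ih (n + 1) (by omega), ih n (by omega),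
        momentFunctional_cSeq_orthoPoly_succ, zero_add, hSeq]

/-- The monic basis `1, X * e_0, X * e_1, …` with `e_k = oddSquareProd k`. -/
noncomputable def shiftedOddSquareProd : ℕ → ℚ[X]
  | 0 => 1
  | k + 1 => X * oddSquareProd k

lemma shiftedOddSquareProd_monic_natDegree (k : ℕ) :
    (shiftedOddSquareProd k).Monic ∧ (shiftedOddSquareProd k).natDegree = k := by
  cases k with
  | zero => simp [shiftedOddSquareProd]
  | succ k =>
    obtain ⟨hm, hd⟩ := oddSquareProd_monic_natDegree k
    refine ⟨monic_X.mul hm, ?_⟩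
    rw [shiftedOddSquareProd, monic_X.natDegree_mul hm, natDegree_X, hd, add_comm]

lemma hankelDet_bSeq_succ (m : ℕ) :
    hankelDet bSeq (m + 1) = (-1) ^ (m + 1) * hSeq (m + 1) * hankelDet cSeq m := by
  rw [hankelDet_eq_det_of_monic bSeq shiftedOddSquareProd orthoPoly
    (fun i => (shiftedOddSquareProd_monic_natDegree i).1)
    (fun i => (shiftedOddSquareProd_monic_natDegree i).2)
    (fun i => (orthoPoly_monic_natDegree i).1) (fun i => (orthoPoly_monic_natDegree i).2),
    hankelDet_eq_det_of_monic cSeq oddSquareProd orthoPoly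
    (fun i => (oddSquareProd_monic_natDegree i).1) (fun i => (oddSquareProd_monic_natDegree i).2)
    (fun i => (orthoPoly_monic_natDegree i).1) (fun i => (orthoPoly_monic_natDegree i).2),
    Matrix.det_succ_column _ (Fin.last (m + 1)), Fin.sum_univ_succ]
  have hrow : ∀ (i : ℕ) (p : ℚ[X]), momentFunctional bSeq (shiftedOddSquareProd (i + 1) * p) =
      momentFunctional cSeq (oddSquareProd i * p) := fun i p => by
    rw [shiftedOddSquareProd, mul_assoc, momentFunctional_bSeq_X_mul]
  -- In the last column, row i+1 holds `L_c (e_i P_{m+1})` with i ≤ m, which is 0.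
  rw [Finset.sum_eq_zero, add_zero]
  · congr 1
    · simp [shiftedOddSquareProd, momentFunctional_bSeq_orthoPoly]
    · congr 1
      ext i j
      simp [hrow]
  · intro i _
    rw [Matrix.of_apply, Fin.val_succ, hrow, Fin.val_last,
      momentFunctional_cSeq_oddSquareProd_mul_orthoPoly, Nat.choose_eq_zero_of_lt i.2]
    simp

end HankelEuler

theorem proposition3p5 (n : ℕ) (hn : 1 ≤ n) :
    HankelEuler.hankelDet HankelEuler.bSeq n =
      (-1 : ℚ) ^ n / ((2 : ℚ) ^ n * (n.factorial : ℚ)) ^ 4 * HankelEuler.hSeq n *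
        HankelEuler.hankelDet HankelEuler.cSeq n := by
  obtain ⟨m, rfl⟩ : ∃ m, n = m + 1 := ⟨n - 1, by omega⟩
  -- The ratio of consecutive determinants is the last diagonal factor, 16^n n!^4 = (2^n n!)^4 at n
  -- = m+1.
  have h : HankelEuler.hankelDet HankelEuler.cSeq (m + 1) =
      HankelEuler.hankelDet HankelEuler.cSeq m *
        ((2 : ℚ) ^ (m + 1) * ((m + 1).factorial : ℚ)) ^ 4 := by
    rw [HankelEuler.hankelDet_cSeq, Finset.prod_range_succ, ← HankelEuler.hankelDet_cSeq, mul_pow,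
      ← pow_mul, mul_comm (m + 1) 4, pow_mul]
    norm_num
  have h0 : ((2 : ℚ) ^ (m + 1) * ((m + 1).factorial : ℚ)) ^ 4 ≠ 0 := by positivity
  rw [HankelEuler.hankelDet_bSeq_succ, h]
  field_simp
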